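/- Let $N$ be a positive integer, let $(\alpha_n)_{n\ge 0}$ and $(\beta_n)_{n\ge 0}$ be real $N$-periodic sequences with $\alpha_n>0$ for all $n$, and suppose that the matrix $$\mathcal F(0)=T_N T_{N-1}\cdots T_1,\qquad T_i=\begin{pmatrix}0&1\\-\frac{\alpha_{i-1}}{\alpha_i}&-\frac{\beta_i}{\alpha_i}\end{pmatrix},$$ equals $\gamma\,\mathrm{Id}$ for some real $\gamma$ with $|\gamma|=1$. Let $(\tilde a_k)_{k\ge 0}$ be an arbitrary sequence of positive numbers, and put $$a_{kN+i}=\alpha_i\tilde a_k,\qquad b_{kN+i}=\beta_i\tilde a_k\qquad(0\le i\le N-1,\ k\ge 0).$$ Let $A$ be the associated Jacobi operator on the complex Hilbert space $\ell^2=\ell^2(\{0,1,2,\dots\})$, that is, with $(\mathcal A x)_0=b_0x_0+a_0x_1$ and $(\mathcal A x)_n=a_{n-1}x_{n-1}+b_nx_n+a_nx_{n+1}$ for $n\ge 1$, let $\mathrm{Dom}(A)=\{x\in\ell^2:\mathcal A x\in\ell^2\}$ and $Ax=\mathcal A x$ for $x\in\mathrm{Dom}(A)$. Let $\sigma_{\mathrm{ess}}(A)$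 be the essential spectrum of $A$, i.e. the set of the points of the spectrum that are not isolated points of the spectrum which are eigenvalues of finite multiplicity. Then: (a) if $\lim_{k\to\infty} k/\tilde a_k=\infty$, then $0\in\sigma_{\mathrm{ess}}(A)$; (b) if the sequence $(k/\tilde a_k)_{k\ge 1}$ is bounded, then $0\notin\sigma_{\mathrm{ess}}(A)$; (c) if $\lim_{k\to\infty} k/\tilde a_k=0$, then $\sigma_{\mathrm{ess}}(A)=\emptyset$. -/

import Mathlib

open Filter Topology

noncomputable section

/-- The complex Hilbert space `ℓ²` of square summable sequences indexed by `n ≥ 0`. -/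
abbrev EllTwo : Type := lp (fun _ : ℕ => ℂ) 2

/-- The transfer matrix `[[0, 1], [-α_{n-1}/α_n, -β_n/α_n]]` at spectral parameter `0`;
it is used only for indices `n ≥ 1`. -/
def transferMatrix (α β : ℕ → ℝ) (n : ℕ) : Matrix (Fin 2) (Fin 2) ℝ :=
  !![0, 1; -(α (n - 1) / α n), -(β n / α n)]

/-- The ordered product `T_n * T_{n-1} * ⋯ * T_1` of transfer matrices, with the factor of
largest index on the left (the identity matrix for `n = 0`). -/
def transferProduct (α β : ℕ → ℝ) : ℕ → Matrix (Fin 2) (Fin 2) ℝ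
  | 0 => 1
  | n + 1 => transferMatrix α β (n + 1) * transferProduct α β n

/-- The formal action on an arbitrary complex sequence of the tridiagonal matrix with diagonal
`b_0, b_1, …` and off-diagonal `a_0, a_1, …`. -/
def jacobiAction (a b : ℕ → ℝ) (x : ℕ → ℂ) : ℕ → ℂ
  | 0 => (b 0 : ℂ) * x 0 + (a 0 : ℂ) * x 1
  | n + 1 => (a n : ℂ) * x n + (b (n + 1) : ℂ) * x (n + 1) + (a (n + 1) : ℂ) * x (n + 2)

theorem jacobiAction_add (a b : ℕ → ℝ) (x y : ℕ → ℂ) :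
    jacobiAction a b (x + y) = jacobiAction a b x + jacobiAction a b y := by
  funext n
  cases n <;> simp only [jacobiAction, Pi.add_apply] <;> ring

theorem jacobiAction_smul (a b : ℕ → ℝ) (c : ℂ) (x : ℕ → ℂ) :
    jacobiAction a b (c • x) = c • jacobiAction a b x := by
  funext n
  cases n <;> simp only [jacobiAction, Pi.smul_apply, smul_eq_mul] <;> ring

/-- The maximal domain `{x ∈ ℓ² : 𝒜 x ∈ ℓ²}`. -/
def jacobiDomain (a b : ℕ → ℝ) : Submodule ℂ EllTwo where
  carrier := {x | Memℓp (jacobiAction a b (x : ℕ → ℂ)) 2}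
  zero_mem' := by
    have h : jacobiAction a b ((0 : EllTwo) : ℕ → ℂ) = 0 := by
      funext n
      cases n <;> simp [jacobiAction]
    show Memℓp (jacobiAction a b ((0 : EllTwo) : ℕ → ℂ)) 2
    rw [h]
    exact zero_memℓp
  add_mem' := by
    intro x y hx hy
    show Memℓp (jacobiAction a b ((x + y : EllTwo) : ℕ → ℂ)) 2
    rw [lp.coeFn_add, jacobiAction_add]
    exact Memℓp.add hx hy
  smul_mem' := by
    intro c x hx
    show Memℓp (jacobiAction a b ((c • x : EllTwo) : ℕ → ℂ)) 2
    rw [lp.coeFn_smul, jacobiAction_smul]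
    exact Memℓp.const_smul hx c

/-- The Jacobi operator `A` on `ℓ²`: the restriction of the formal matrix action to its
maximal domain. -/
def jacobiOperator (a b : ℕ → ℝ) : EllTwo →ₗ.[ℂ] EllTwo where
  domain := jacobiDomain a b
  toFun :=
    { toFun := fun x => ⟨jacobiAction a b ((x : EllTwo) : ℕ → ℂ), x.2⟩
      map_add' := fun x y => by
        apply Subtype.ext
        exact jacobiAction_add a b _ _
      map_smul' := fun c x => by
        apply Subtype.ext
        exact jacobiAction_smul a b c _ }

section Spectrum

variable {H : Type*} [NormedAddCommGroup H] [InnerProductSpace ℂ H]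

/-- The resolvent set of an operator `T` with domain `T.domain`: the complex numbers `z` for which
`T - z : T.domain → H` has an everywhere defined bounded two-sided inverse `R`. -/
def opResolventSet (T : H →ₗ.[ℂ] H) : Set ℂ :=
  {z | ∃ R : H →L[ℂ] H,
      (∀ y : H, ∃ h : R y ∈ T.domain, T ⟨R y, h⟩ - z • R y = y) ∧
      ∀ x : T.domain, R (T x - z • (x : H)) = x}

/-- The spectrum: the complement of the resolvent set. -/
def opSpectrum (T : H →ₗ.[ℂ] H) : Set ℂ := (opResolventSet T)ᶜ

/-- The eigenspace `ker (T - z)`, as a subspace of the domain of `T`. -/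
def opEigenspace (T : H →ₗ.[ℂ] H) (z : ℂ) : Submodule ℂ T.domain :=
  LinearMap.ker (T.toFun - z • T.domain.subtype)

/-- The discrete spectrum of a self-adjoint operator: the isolated points of the spectrum that are
eigenvalues of finite multiplicity. -/
def opDiscreteSpectrum (T : H →ₗ.[ℂ] H) : Set ℂ :=
  {z | z ∈ opSpectrum T ∧ (∀ᶠ w in 𝓝[≠] z, w ∉ opSpectrum T) ∧
      opEigenspace T z ≠ ⊥ ∧ FiniteDimensional ℂ (opEigenspace T z)}

/-- The essential spectrum of a self-adjoint operator: the part of the spectrum that is not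
discrete. -/
def opEssentialSpectrum (T : H →ₗ.[ℂ] H) : Set ℂ := opSpectrum T \ opDiscreteSpectrum T

end Spectrum

end

/-!
At spectral parameter `0` the modulated Jacobi recurrence can be solved explicitly. Let `p` and `v`
be the solutions of the unmodulated recurrence (entries `α`, `β`) with `β 0 * p 0 + α 0 * p 1 = 0`,
`p 0 = 1`, and with `v 0 = 0`, `α 0 * v 1 = 1`. Because the transfer matrix over a period is
`γ • 1`, both are periodic up to the sign `γ`, hence bounded, and at the start of every block `p`
satisfies the initial condition again while `v` vanishes. The modulation therefore decouples:
`p` and `q n = v n / t (n / N)` solve the modulated recurrence (`isJacobiSolution_regularSolution`,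
`isJacobiSolution_vanishingSolution_div`). As `p (k * N) = γ ^ k`, the solution `p` is not in `ℓ²`
and `0` is never an eigenvalue.

If `k / t k → ∞`, the off-diagonal entries are `o(n)`, and cutting `p` off linearly between `L` and
`2 * L` gives vectors showing that the operator is not bounded below
(`zero_mem_opSpectrum_of_isLittleO`). So `0` is in the spectrum without being an eigenvalue.

If `k / t k` is bounded, then `q = O(1 / n)` and the Green kernel built from `p` and `q` is dominated
by `c / (max n m + 1)`. The Schur test with weights `(n + 1)^(-1/2)` makes it a bounded operator
(`kernelOperator`), which is the inverse of the Jacobi operator.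

If `k / t k → 0`, then `q = o(1 / n)` and this inverse is compact and symmetric. An operator with such
an inverse has no essential spectrum (`opEssentialSpectrum_eq_empty`): by the Fredholm alternative
each point of the spectrum is an eigenvalue, of finite multiplicity by compactness, and eigenvalues
cannot accumulate because eigenvectors for different eigenvalues are orthogonal.
-/

noncomputable section

/-! ### Operators with compact symmetric inverse -/

section CompactInverse

variable {H : Type*} [NormedAddCommGroup H] [InnerProductSpace ℂ H]

open scoped InnerProductSpace

theorem opEigenspace_eq_bot_iff (T : H →ₗ.[ℂ] H) (z : ℂ) :
    opEigenspace T z = ⊥ ↔ ∀ x : T.domain, T x = z • (x : H) → x = 0 := by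
  rw [opEigenspace, LinearMap.ker_eq_bot']
  refine forall_congr' fun x => ?_
  rw [← sub_eq_zero (a := T x)]
  rfl

/-- An operator with an everywhere defined inverse `R` turns eigenvectors for `z` into eigenvectors
of `R` for `z⁻¹`. -/
theorem inverse_apply_of_eigenvector {T : H →ₗ.[ℂ] H} {R : H →L[ℂ] H}
    (hRT : ∀ x : T.domain, R (T x) = x) {z : ℂ} (hz : z ≠ 0) {x : T.domain}
    (hx : T x = z • (x : H)) : R (x : H) = z⁻¹ • (x : H) := by
  rw [eq_inv_smul_iff₀ hz, ← map_smul, ← hx, hRT]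

theorem zero_mem_opResolventSet {T : H →ₗ.[ℂ] H} {R : H →L[ℂ] H}
    (hTR : ∀ y : H, ∃ h : R y ∈ T.domain, T ⟨R y, h⟩ = y)
    (hRT : ∀ x : T.domain, R (T x) = x) : (0 : ℂ) ∈ opResolventSet T := by
  refine ⟨R, fun y => ?_, fun x => ?_⟩
  · obtain ⟨h, e⟩ := hTR y
    exact ⟨h, by rw [zero_smul, sub_zero, e]⟩
  · rw [zero_smul, sub_zero, hRT]

/-- Fredholm alternative: for an operator with compact inverse every point of the spectrum is an
eigenvalue. -/
theorem mem_opResolventSet_of_opEigenspace_eq_bot [CompleteSpace H]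
    {T : H →ₗ.[ℂ] H} {R : H →L[ℂ] H}
    (hTR : ∀ y : H, ∃ h : R y ∈ T.domain, T ⟨R y, h⟩ = y)
    (hRT : ∀ x : T.domain, R (T x) = x) (hR : IsCompactOperator R)
    {z : ℂ} (hz : opEigenspace T z = ⊥) : z ∈ opResolventSet T := by
  rcases eq_or_ne z 0 with rfl | hz0
  · exact zero_mem_opResolventSet hTR hRT
  rw [opEigenspace_eq_bot_iff] at hz
  have hev : ¬ Module.End.HasEigenvalue (R : Module.End ℂ H) z⁻¹ := by
    intro hv
    obtain ⟨v, hv⟩ := hv.exists_hasEigenvector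
    have hv1 : R v = z⁻¹ • v := hv.apply_eq_smul
    obtain ⟨h, e⟩ := hTR (z • v)
    have h2 : R (z • v) = v := by rw [map_smul, hv1, smul_inv_smul₀ hz0]
    have := hz ⟨R (z • v), h⟩ (by rw [e]; simp only [h2])
    exact hv.2 (by rw [← h2]; exact congrArg Subtype.val this)
  have hres : z⁻¹ ∈ resolventSet ℂ R :=
    (hR.hasEigenvalue_or_mem_resolventSet (inv_ne_zero hz0)).resolve_left hev
  rw [spectrum.mem_resolventSet_iff] at hres
  obtain ⟨u, hu⟩ := hres
  -- `u = z⁻¹ - R`, so `(T - z)⁻¹ = R (1 - zR)⁻¹ = z⁻¹ R u⁻¹`.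
  have huapp : ∀ y, (u : H →L[ℂ] H) y = z⁻¹ • y - R y := fun y => by
    rw [hu]; simp [Algebra.algebraMap_eq_smul_one]
  have hinv : ∀ y, (u : H →L[ℂ] H) ((↑u⁻¹ : H →L[ℂ] H) y) = y := fun y => by
    rw [← mul_apply_eq_comp, Units.mul_inv]; rfl
  have hinv' : ∀ y, (↑u⁻¹ : H →L[ℂ] H) ((u : H →L[ℂ] H) y) = y := fun y => by
    rw [← mul_apply_eq_comp, Units.inv_mul]; rfl
  refine ⟨z⁻¹ • (R * (↑u⁻¹ : H →L[ℂ] H)), fun y => ?_, fun x => ?_⟩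
  · have e0 : (z⁻¹ • (R * (↑u⁻¹ : H →L[ℂ] H))) y = R (z⁻¹ • (↑u⁻¹ : H →L[ℂ] H) y) := by
      simp
    rw [e0]
    obtain ⟨h, e⟩ := hTR (z⁻¹ • (↑u⁻¹ : H →L[ℂ] H) y)
    refine ⟨h, ?_⟩
    rw [e, map_smul, smul_inv_smul₀ hz0]
    have := hinv y
    rwa [huapp] at this
  · have e1 : T x - z • (x : H) = z • (u : H →L[ℂ] H) (T x) := by
      rw [huapp, hRT, smul_sub, smul_inv_smul₀ hz0]
    rw [e1]
    simp [hinv', hRT, hz0]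

/-- The eigenvalues of an operator with compact symmetric inverse do not accumulate at a finite
point: a limit of unit eigenvectors for eigenvalues tending to `z` would be an eigenvector for `z`,
orthogonal to all of them and hence to itself. -/
theorem eventually_opEigenspace_eq_bot {T : H →ₗ.[ℂ] H} {R : H →L[ℂ] H}
    (hRT : ∀ x : T.domain, R (T x) = x) (hR : IsCompactOperator R)
    (hs : (R : H →ₗ[ℂ] H).IsSymmetric) {z : ℂ} (hz0 : z ≠ 0) :
    ∀ᶠ w in 𝓝[≠] z, opEigenspace T w = ⊥ := by
  by_contra hcon
  have hfr : ∃ᶠ w in 𝓝[≠] z, opEigenspace T w ≠ ⊥ := not_eventually.1 hcon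
  have hne : ∀ᶠ w in 𝓝[≠] z, w ≠ 0 ∧ w ≠ z :=
    ((eventually_ne_nhds hz0).filter_mono nhdsWithin_le_nhds).and
      eventually_mem_nhdsWithin
  obtain ⟨w, hw, hw'⟩ := exists_seq_forall_of_frequently (hfr.and_eventually hne)
  have key : ∀ n, ∃ x : H, ‖x‖ = 1 ∧ R x = (w n)⁻¹ • x := by
    intro n
    obtain ⟨h1, h2, h3⟩ := hw' n
    rw [Ne, opEigenspace_eq_bot_iff] at h1
    push Not at h1
    obtain ⟨x, hx, hx0⟩ := h1
    have hx0' : (x : H) ≠ 0 := fun h => hx0 (Subtype.ext h)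
    have := inverse_apply_of_eigenvector hRT h2 hx
    refine ⟨((‖(x : H)‖⁻¹ : ℝ) : ℂ) • (x : H), ?_, ?_⟩
    · rw [norm_smul]; simp [hx0']
    · rw [map_smul, this, smul_comm]
  choose x hx1 hxR using key
  obtain ⟨K, hK, hsub⟩ := IsCompactOperator.image_closedBall_subset_compact
    (f := (R : H →ₗ[ℂ] H)) hR 1
  obtain ⟨y, -, φ, hφ, hy⟩ := hK.tendsto_subseq (x := fun n => R (x n))
    (fun n => hsub ⟨x n, by simp [hx1], rfl⟩)
  have hwφ : Tendsto (fun n => w (φ n)) atTop (𝓝 z) :=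
    (tendsto_nhds_of_tendsto_nhdsWithin hw).comp hφ.tendsto_atTop
  have hlim : Tendsto (fun n => x (φ n)) atTop (𝓝 (z • y)) := by
    refine (hwφ.smul hy).congr fun n => ?_
    simp only [Function.comp_apply]
    rw [hxR, smul_inv_smul₀ (hw' _).2.1]
  set v := z • y with hv
  have hv1 : ‖v‖ = 1 := tendsto_nhds_unique hlim.norm (by simp [hx1])
  have hRv : R v = z⁻¹ • v := by
    rw [tendsto_nhds_unique ((R.continuous.tendsto v).comp hlim) hy, hv, inv_smul_smul₀ hz0]
  have horth : ∀ n, ⟪v, x n⟫_ℂ = 0 := fun n => by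
    have hne' : z⁻¹ ≠ (w n)⁻¹ := fun h => (hw' n).2.2 (inv_injective h).symm
    refine hs.orthogonalFamily_eigenspaces hne'
      (⟨v, ?_⟩ : Module.End.eigenspace (R : H →ₗ[ℂ] H) z⁻¹)
      (⟨x n, ?_⟩ : Module.End.eigenspace (R : H →ₗ[ℂ] H) (w n)⁻¹)
    · exact Module.End.mem_eigenspace_iff.2 hRv
    · exact Module.End.mem_eigenspace_iff.2 (hxR n)
  have h0 : ⟪v, v⟫_ℂ = 0 := by
    refine tendsto_nhds_unique (tendsto_const_nhds.inner hlim) ?_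
    simp [horth]
  rw [inner_self_eq_zero] at h0
  simp [h0] at hv1

theorem finiteDimensional_opEigenspace [CompleteSpace H] {T : H →ₗ.[ℂ] H} {R : H →L[ℂ] H}
    (hRT : ∀ x : T.domain, R (T x) = x) (hR : IsCompactOperator R) {z : ℂ} (hz0 : z ≠ 0) :
    FiniteDimensional ℂ (opEigenspace T z) := by
  have hfin : FiniteDimensional ℂ (Module.End.eigenspace (R : Module.End ℂ H) z⁻¹) :=
    ContinuousLinearMap.finite_dimensional_eigenspace hR z⁻¹ (inv_ne_zero hz0)
  refine FiniteDimensional.of_injective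
    (LinearMap.codRestrict (Module.End.eigenspace (R : Module.End ℂ H) z⁻¹)
      (T.domain.subtype ∘ₗ (opEigenspace T z).subtype) fun x => ?_) ?_
  · have hx : T x.1 = z • (x.1 : H) := sub_eq_zero.1 (LinearMap.mem_ker.1 x.2)
    exact Module.End.mem_eigenspace_iff.2 (inverse_apply_of_eigenvector hRT hz0 hx)
  · intro x y h
    have h' : ((x.1 : T.domain) : H) = y.1 :=
      congrArg (fun v : Module.End.eigenspace (R : Module.End ℂ H) z⁻¹ => (v : H)) h
    exact Subtype.ext (Subtype.ext h')

theorem opEssentialSpectrum_eq_empty [CompleteSpace H] {T : H →ₗ.[ℂ] H} {R : H →L[ℂ] H}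
    (hTR : ∀ y : H, ∃ h : R y ∈ T.domain, T ⟨R y, h⟩ = y)
    (hRT : ∀ x : T.domain, R (T x) = x) (hR : IsCompactOperator R)
    (hs : (R : H →ₗ[ℂ] H).IsSymmetric) : opEssentialSpectrum T = ∅ := by
  refine Set.sdiff_eq_empty.2 fun z hz => ?_
  have hz0 : z ≠ 0 := by
    rintro rfl
    exact hz (zero_mem_opResolventSet hTR hRT)
  refine ⟨hz, ?_, fun h => hz (mem_opResolventSet_of_opEigenspace_eq_bot hTR hRT hR h),
    finiteDimensional_opEigenspace hRT hR hz0⟩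
  filter_upwards [eventually_opEigenspace_eq_bot hRT hR hs hz0] with w hw
  exact fun h => h (mem_opResolventSet_of_opEigenspace_eq_bot hTR hRT hR hw)

end CompactInverse

/-! ### Integral operators dominated by a Hardy-type kernel -/

/-- The weight of the Schur test: `∑ₘ 1 / (max n m + 1) * (m + 1)^(-1/2) ≤ 4 (n + 1)^(-1/2)`. -/
theorem sum_inv_max_mul_inv_sqrt_le (n M : ℕ) :
    ∑ m ∈ Finset.range M, 1 / ((max n m : ℕ) + 1 : ℝ) * (1 / √(m + 1)) ≤ 4 * (1 / √(n + 1)) := by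
  -- The partial sums are bounded by `2 √M / (n + 1)` up to `M = n + 1` and by
  -- `4 / √(n + 1) - 2 / √M` from there on.
  have key : ∀ M : ℕ, ∑ m ∈ Finset.range M, 1 / ((max n m : ℕ) + 1 : ℝ) * (1 / √(m + 1)) ≤
      if M ≤ n + 1 then 2 * √M / (n + 1) else 4 * (1 / √(n + 1)) - 2 / √M := by
    intro M
    induction M with
    | zero => simp
    | succ M ih =>
      rw [Finset.sum_range_succ]
      set s := √(M : ℝ) with hs
      set r := √((M : ℝ) + 1) with hr
      have hs0 : 0 ≤ s := Real.sqrt_nonneg _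
      have hr0 : 0 < r := Real.sqrt_pos.2 (by positivity)
      have hs2 : s ^ 2 = M := Real.sq_sqrt (by positivity)
      have hr2 : r ^ 2 = M + 1 := Real.sq_sqrt (by positivity)
      have hsr : s ≤ r := Real.sqrt_le_sqrt (by linarith)
      have hcast : ((M + 1 : ℕ) : ℝ) = M + 1 := by push_cast; rfl
      rw [hcast, ← hr]
      have hstep1 : 1 / r ≤ 2 * r - 2 * s := by
        rw [div_le_iff₀ hr0]; nlinarith [sq_nonneg (r - s)]
      rcases lt_trichotomy M (n + 1) with h | h | h
      · rw [if_pos h.le] at ih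
        rw [if_pos (by omega), max_eq_left (by exact_mod_cast (by omega : M ≤ n))]
        have hn : (0 : ℝ) < n + 1 := by positivity
        have : 1 / ((n : ℝ) + 1) * (1 / r) ≤ 1 / ((n : ℝ) + 1) * (2 * r - 2 * s) := by gcongr
        calc _ ≤ 2 * s / (n + 1) + 1 / ((n : ℝ) + 1) * (2 * r - 2 * s) := by gcongr
          _ = _ := by ring
      all_goals
        have hM : 0 < M := by omega
        have hs0' : 0 < s := Real.sqrt_pos.2 (by exact_mod_cast hM)
        have hstep2 : 1 / ((M : ℝ) + 1) * (1 / r) ≤ 2 / s - 2 / r := by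
          rw [← hr2]
          have : 2 / s - 2 / r = (2 * r - 2 * s) * (1 / (s * r)) := by field_simp
          rw [this]
          calc 1 / r ^ 2 * (1 / r) = (1 / r) * (1 / (r * r)) := by ring
            _ ≤ (2 * r - 2 * s) * (1 / (s * r)) := by
              gcongr
              exact le_trans (by positivity) hstep1
      · rw [if_pos h.le] at ih
        rw [if_neg (by omega), max_eq_right (by exact_mod_cast (by omega : n ≤ M))]
        have hn : (n : ℝ) + 1 = M := by rw [h]; push_cast; ring
        rw [hn] at ih ⊢
        rw [← hs]
        have : 2 * s / (M : ℝ) = 2 / s := by rw [← hs2]; field_simp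
        rw [this] at ih
        have e : 4 * (1 / s) = 2 / s + 2 / s := by ring
        linarith
      · rw [if_neg (by omega)] at ih
        rw [if_neg (by omega), max_eq_right (by exact_mod_cast (by omega : n ≤ M))]
        linarith
  refine (key M).trans ?_
  split_ifs with h
  · have hn : (0 : ℝ) < √((n : ℝ) + 1) := Real.sqrt_pos.2 (by positivity)
    have hle : √(M : ℝ) ≤ √((n : ℝ) + 1) := Real.sqrt_le_sqrt (by exact_mod_cast h)
    have hsq : √((n : ℝ) + 1) ^ 2 = n + 1 := Real.sq_sqrt (by positivity)
    set u := √((n : ℝ) + 1)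
    calc 2 * √(M : ℝ) / (n + 1) ≤ 2 * u / (n + 1) := by gcongr
      _ = 2 * (1 / u) := by rw [← hsq]; field_simp
      _ ≤ 4 * (1 / u) := by gcongr; norm_num
  · have : 0 ≤ 2 / √(M : ℝ) := by positivity
    linarith

/-- Schur test on finite sections. -/
theorem sum_sq_sum_inv_max_le (f : ℕ → ℝ) (L M : ℕ) :
    ∑ n ∈ Finset.range L, (∑ m ∈ Finset.range M, 1 / ((max n m : ℕ) + 1 : ℝ) * |f m|) ^ 2 ≤
      16 * ∑ m ∈ Finset.range M, |f m| ^ 2 := by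
  set k : ℕ → ℕ → ℝ := fun n m => 1 / ((max n m : ℕ) + 1 : ℝ) with hk
  set w : ℕ → ℝ := fun n => 1 / √((n : ℝ) + 1) with hw
  have hk0 : ∀ n m, 0 ≤ k n m := fun n m => by positivity
  have hw0 : ∀ n, 0 < w n := fun n => by positivity
  have hrow : ∀ n M, ∑ m ∈ Finset.range M, k n m * w m ≤ 4 * w n := fun n M =>
    sum_inv_max_mul_inv_sqrt_le n M
  have hsymm : ∀ n m, k n m = k m n := fun n m => by simp only [hk, max_comm]
  have hcs : ∀ n, (∑ m ∈ Finset.range M, k n m * |f m|) ^ 2 ≤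
      4 * w n * ∑ m ∈ Finset.range M, k n m * (|f m| ^ 2 / w m) := by
    intro n
    calc (∑ m ∈ Finset.range M, k n m * |f m|) ^ 2
        ≤ (∑ m ∈ Finset.range M, k n m * w m) *
            ∑ m ∈ Finset.range M, k n m * (|f m| ^ 2 / w m) := by
          refine Finset.sum_sq_le_sum_mul_sum_of_sq_le_mul _ (fun m _ => ?_) (fun m _ => ?_)
            (fun m _ => ?_)
          · exact mul_nonneg (hk0 _ _) (hw0 _).le
          · exact mul_nonneg (hk0 _ _) (div_nonneg (by positivity) (hw0 _).le)
          · have := (hw0 m).ne'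
            exact le_of_eq (by field_simp)
      _ ≤ _ := mul_le_mul_of_nonneg_right (hrow n M) (Finset.sum_nonneg fun m _ =>
          mul_nonneg (hk0 _ _) (div_nonneg (by positivity) (hw0 _).le))
  calc _ ≤ ∑ n ∈ Finset.range L,
        4 * w n * ∑ m ∈ Finset.range M, k n m * (|f m| ^ 2 / w m) :=
        Finset.sum_le_sum fun n _ => hcs n
    _ = ∑ m ∈ Finset.range M, 4 * (|f m| ^ 2 / w m) * ∑ n ∈ Finset.range L, k m n * w n := by
        simp_rw [Finset.mul_sum]
        rw [Finset.sum_comm]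
        refine Finset.sum_congr rfl fun m _ => Finset.sum_congr rfl fun n _ => ?_
        rw [hsymm n m]; ring
    _ ≤ ∑ m ∈ Finset.range M, 4 * (|f m| ^ 2 / w m) * (4 * w m) := by
        refine Finset.sum_le_sum fun m _ => mul_le_mul_of_nonneg_left (hrow m L) ?_
        exact mul_nonneg (by norm_num) (div_nonneg (by positivity) (hw0 _).le)
    _ = _ := by
        rw [Finset.mul_sum]
        refine Finset.sum_congr rfl fun m _ => ?_
        have := (hw0 m).ne'
        field_simp
        ring

theorem EllTwo.hasSum_norm_sq (f : EllTwo) : HasSum (fun n => ‖f n‖ ^ 2) (‖f‖ ^ 2) := by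
  simpa using lp.hasSum_norm (p := 2) (by norm_num) f

theorem EllTwo.sum_norm_sq_le (f : EllTwo) (s : Finset ℕ) : ∑ n ∈ s, ‖f n‖ ^ 2 ≤ ‖f‖ ^ 2 :=
  sum_le_hasSum s (fun _ _ => by positivity) (EllTwo.hasSum_norm_sq f)

theorem EllTwo.norm_le_of_sum_range_le {f : EllTwo} {C : ℝ} (hC : 0 ≤ C)
    (h : ∀ L, ∑ n ∈ Finset.range L, ‖f n‖ ^ 2 ≤ C ^ 2) : ‖f‖ ≤ C :=
  abs_le_of_sq_le_sq' (le_of_tendsto' (EllTwo.hasSum_norm_sq f).tendsto_sum_nat h) hC |>.2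

theorem memℓp_two_of_sum_range_le {f : ℕ → ℂ} {C : ℝ}
    (h : ∀ L, ∑ n ∈ Finset.range L, ‖f n‖ ^ 2 ≤ C) : Memℓp f 2 := by
  refine memℓp_gen ?_
  have := summable_of_sum_range_le (f := fun n => ‖f n‖ ^ 2) (fun _ => by positivity) h
  simpa using this

section Kernel

variable {k : ℕ → ℕ → ℝ} {c : ℝ}

theorem sum_norm_kernel_le (hk : ∀ n m, |k n m| ≤ c / ((max n m : ℕ) + 1 : ℝ)) (f : EllTwo)
    (n M : ℕ) : ∑ m ∈ Finset.range M, ‖(k n m : ℂ) * f m‖ ≤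
      c * ∑ m ∈ Finset.range M, 1 / ((max n m : ℕ) + 1 : ℝ) * |‖f m‖| := by
  rw [Finset.mul_sum]
  refine Finset.sum_le_sum fun m _ => ?_
  rw [norm_mul, Complex.norm_real, Real.norm_eq_abs, abs_of_nonneg (norm_nonneg (f m))]
  calc _ ≤ c / ((max n m : ℕ) + 1 : ℝ) * ‖f m‖ := by gcongr; exact hk n m
    _ = _ := by ring

theorem sum_sq_sum_norm_kernel_le (hk : ∀ n m, |k n m| ≤ c / ((max n m : ℕ) + 1 : ℝ))
    (f : EllTwo) (L M : ℕ) :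
    ∑ n ∈ Finset.range L, (∑ m ∈ Finset.range M, ‖(k n m : ℂ) * f m‖) ^ 2 ≤
      (4 * c * ‖f‖) ^ 2 := by
  calc _ ≤ ∑ n ∈ Finset.range L,
        (c * ∑ m ∈ Finset.range M, 1 / ((max n m : ℕ) + 1 : ℝ) * |‖f m‖|) ^ 2 := by
        gcongr with n
        exact sum_norm_kernel_le hk f n M
    _ = c ^ 2 * ∑ n ∈ Finset.range L,
        (∑ m ∈ Finset.range M, 1 / ((max n m : ℕ) + 1 : ℝ) * |‖f m‖|) ^ 2 := by
        rw [Finset.mul_sum]; simp_rw [mul_pow]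
    _ ≤ c ^ 2 * (16 * ∑ m ∈ Finset.range M, |‖f m‖| ^ 2) := by
        gcongr
        exact sum_sq_sum_inv_max_le (fun m => ‖f m‖) L M
    _ ≤ c ^ 2 * (16 * ‖f‖ ^ 2) := by
        gcongr
        simpa using EllTwo.sum_norm_sq_le f (Finset.range M)
    _ = _ := by ring

theorem summable_kernel (hk : ∀ n m, |k n m| ≤ c / ((max n m : ℕ) + 1 : ℝ)) (f : EllTwo) (n : ℕ) :
    Summable fun m => (k n m : ℂ) * f m := by
  refine Summable.of_norm (summable_of_sum_range_le (c := |4 * c * ‖f‖|)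
    (fun _ => norm_nonneg _) fun M => ?_)
  refine (le_abs_self _).trans (sq_le_sq.1 (le_trans ?_ (sum_sq_sum_norm_kernel_le hk f (n + 1) M)))
  exact Finset.single_le_sum (f := fun n => (∑ m ∈ Finset.range M, ‖(k n m : ℂ) * f m‖) ^ 2)
    (fun _ _ => sq_nonneg _) (Finset.self_mem_range_succ n)

theorem sum_norm_sq_tsum_kernel_le (hk : ∀ n m, |k n m| ≤ c / ((max n m : ℕ) + 1 : ℝ))
    (f : EllTwo) (L : ℕ) :
    ∑ n ∈ Finset.range L, ‖∑' m, (k n m : ℂ) * f m‖ ^ 2 ≤ (4 * c * ‖f‖) ^ 2 := by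
  have hlim : Tendsto (fun M => ∑ n ∈ Finset.range L,
      ‖∑ m ∈ Finset.range M, (k n m : ℂ) * f m‖ ^ 2) atTop
      (𝓝 (∑ n ∈ Finset.range L, ‖∑' m, (k n m : ℂ) * f m‖ ^ 2)) :=
    tendsto_finsetSum _ fun n _ =>
      ((summable_kernel hk f n).hasSum.tendsto_sum_nat.norm.pow 2)
  refine le_of_tendsto' hlim fun M => le_trans ?_ (sum_sq_sum_norm_kernel_le hk f L M)
  gcongr with n
  exact norm_sum_le _ _

/-- The integral operator on `ℓ²` with a real kernel dominated by the Hardy-type kernel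
`c / (max n m + 1)`. -/
def kernelOperator (k : ℕ → ℕ → ℝ) (c : ℝ)
    (hk : ∀ n m, |k n m| ≤ c / ((max n m : ℕ) + 1 : ℝ)) : EllTwo →L[ℂ] EllTwo :=
  LinearMap.mkContinuous
    { toFun := fun f => ⟨fun n => ∑' m, (k n m : ℂ) * f m,
        memℓp_two_of_sum_range_le (sum_norm_sq_tsum_kernel_le hk f)⟩
      map_add' := fun f g => by
        ext n
        simp only [lp.coeFn_add, Pi.add_apply]
        rw [← (summable_kernel hk f n).tsum_add (summable_kernel hk g n)]
        simp only [mul_add]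
      map_smul' := fun z f => by
        ext n
        simp only [lp.coeFn_smul, Pi.smul_apply, smul_eq_mul, RingHom.id_apply]
        rw [← tsum_mul_left]
        simp only [mul_left_comm] }
    (4 * c) fun f => by
      have hc : 0 ≤ c := by simpa using (abs_nonneg _).trans (hk 0 0)
      exact EllTwo.norm_le_of_sum_range_le (by positivity) (sum_norm_sq_tsum_kernel_le hk f)

theorem kernelOperator_apply (hk : ∀ n m, |k n m| ≤ c / ((max n m : ℕ) + 1 : ℝ)) (f : EllTwo)
    (n : ℕ) : kernelOperator k c hk f n = ∑' m, (k n m : ℂ) * f m := rfl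

theorem norm_kernelOperator_le (hk : ∀ n m, |k n m| ≤ c / ((max n m : ℕ) + 1 : ℝ)) :
    ‖kernelOperator k c hk‖ ≤ 4 * c := by
  have hc : 0 ≤ c := by simpa using (abs_nonneg _).trans (hk 0 0)
  exact LinearMap.mkContinuous_norm_le _ (by positivity) _

/-- The adjoint agrees with the operator on the standard basis vectors. -/
theorem kernelOperator_isSymmetric (hk : ∀ n m, |k n m| ≤ c / ((max n m : ℕ) + 1 : ℝ))
    (hsymm : ∀ n m, k n m = k m n) :
    (kernelOperator k c hk : EllTwo →ₗ[ℂ] EllTwo).IsSymmetric := by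
  have hsingle : ∀ i j : ℕ,
      kernelOperator k c hk (lp.single 2 i (1 : ℂ)) j = (k j i : ℂ) := fun i j => by
    rw [kernelOperator_apply, tsum_eq_single i]
    · simp
    · intro m hm
      simp [Pi.single_eq_of_ne hm]
  rw [← ContinuousLinearMap.isSelfAdjoint_iff_isSymmetric, ContinuousLinearMap.isSelfAdjoint_iff']
  refine lp.ext_continuousLinearMap (by norm_num) fun i => ?_
  ext j
  have h := lp.inner_single_left (𝕜 := ℂ) (G := fun _ : ℕ => ℂ) j (1 : ℂ)
    (ContinuousLinearMap.adjoint (kernelOperator k c hk) (lp.single 2 i (1 : ℂ)))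
  rw [ContinuousLinearMap.adjoint_inner_right, lp.inner_single_right, hsingle] at h
  simp only [ContinuousLinearMap.comp_apply, lp.singleContinuousLinearMap_apply, hsingle]
  simp at h
  rw [← h, hsymm]

/-- If the kernel is even `o(1 / max n m)`, the operator is the norm limit of its row truncations,
which have finite rank. -/
theorem kernelOperator_isCompactOperator (hk : ∀ n m, |k n m| ≤ c / ((max n m : ℕ) + 1 : ℝ))
    (hsmall : ∀ ε > 0, ∃ L : ℕ, ∀ n ≥ L, ∀ m, |k n m| ≤ ε / ((max n m : ℕ) + 1 : ℝ)) :
    IsCompactOperator (kernelOperator k c hk) := by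
  set G := kernelOperator k c hk with hG
  let P : ℕ → EllTwo →L[ℂ] EllTwo := fun L => ∑ n ∈ Finset.range L,
    (lp.singleContinuousLinearMap ℂ (fun _ : ℕ => ℂ) 2 n) ∘L (lp.evalCLM ℂ (fun _ : ℕ => ℂ) 2 n)
  have hP : ∀ L (f : EllTwo) n, P L f n = if n < L then f n else 0 := by
    intro L f n
    simp only [P, sum_apply, lp.coeFn_sum, Finset.sum_apply,
      ContinuousLinearMap.comp_apply, lp.singleContinuousLinearMap_apply, lp.single_apply]
    rw [Finset.sum_pi_single]
    simp [lp.evalCLM]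
  have hPc : ∀ L, IsCompactOperator (P L ∘L G) := by
    intro L
    refine IsCompactOperator.comp_clm ?_ G
    show P L ∈ compactOperator (RingHom.id ℂ) EllTwo EllTwo
    refine Submodule.sum_mem _ fun n _ => ?_
    exact (isCompactOperator_of_locallyCompactSpace_rng
      (lp.singleContinuousLinearMap ℂ (fun _ : ℕ => ℂ) 2 n)).comp_clm _
  refine isCompactOperator_of_tendsto (l := atTop) (F := fun L => P L ∘L G) ?_
    (Eventually.of_forall hPc)
  rw [Metric.tendsto_atTop]
  intro ε hε
  obtain ⟨L₀, hL₀⟩ := hsmall (ε / 8) (by positivity)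
  refine ⟨L₀, fun L hL => ?_⟩
  have hk' : ∀ n m, |if n < L then 0 else k n m| ≤ (ε / 8) / ((max n m : ℕ) + 1 : ℝ) := by
    intro n m
    split_ifs with h
    · rw [abs_zero]; positivity
    · exact hL₀ n (by omega) m
  have hdiff : G - P L ∘L G = kernelOperator _ _ hk' := by
    ext f n
    have e1 : ((G - P L ∘L G) f) n = G f n - P L (G f) n := rfl
    have e2 := kernelOperator_apply hk f n
    have e3 := kernelOperator_apply hk' f n
    rw [← hG] at e2
    rw [e1, hP, e3]
    split_ifs with h
    · simp
    · rw [sub_zero, e2]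
  rw [dist_comm, dist_eq_norm, hdiff]
  refine (norm_kernelOperator_le hk').trans_lt (by linarith)

end Kernel

/-! ### Green kernel and singular sequences of a Jacobi operator -/

/-- The three-term recurrence of the Jacobi matrix at spectral parameter `0`, at the indices
`n + 1 ≥ 1`. The equation at the index `0` is a separate initial condition. -/
def IsJacobiSolution (a b p : ℕ → ℝ) : Prop :=
  ∀ n, a n * p n + b (n + 1) * p (n + 1) + a (n + 1) * p (n + 2) = 0

/-- The Green kernel at spectral parameter `0` built from two solutions of the recurrence: `p`
satisfies the initial condition at the index `0`, and `q` is the solution that is small at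
infinity. -/
def greenKernel (p q : ℕ → ℝ) (n m : ℕ) : ℝ := if m ≤ n then q n * p m else p n * q m

theorem greenKernel_symm (p q : ℕ → ℝ) (n m : ℕ) : greenKernel p q n m = greenKernel p q m n := by
  unfold greenKernel
  rcases lt_trichotomy n m with h | rfl | h
  · rw [if_neg (by omega), if_pos h.le, mul_comm]
  · rfl
  · rw [if_pos h.le, if_neg (by omega), mul_comm]

theorem abs_greenKernel_le {p q : ℕ → ℝ} {M D : ℝ} {n m : ℕ} (hp : ∀ n, |p n| ≤ M)
    (hq : |q (max n m)| ≤ D / ((max n m : ℕ) + 1 : ℝ)) :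
    |greenKernel p q n m| ≤ M * D / ((max n m : ℕ) + 1 : ℝ) := by
  have hM : 0 ≤ M := (abs_nonneg _).trans (hp 0)
  unfold greenKernel
  split_ifs with h
  · rw [max_eq_left h] at hq ⊢
    rw [abs_mul, mul_comm, mul_div_assoc]
    exact mul_le_mul (hp m) hq (abs_nonneg _) hM
  · rw [max_eq_right (by omega)] at hq ⊢
    rw [abs_mul, mul_div_assoc]
    exact mul_le_mul (hp n) hq (abs_nonneg _) hM

section Jacobi

variable {a b p q : ℕ → ℝ}

theorem IsJacobiSolution.wronskian (hp : IsJacobiSolution a b p) (hq : IsJacobiSolution a b q)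
    (n : ℕ) : a n * (p n * q (n + 1) - p (n + 1) * q n) = a 0 * (p 0 * q 1 - p 1 * q 0) := by
  induction n with
  | zero => rfl
  | succ n ih =>
    rw [← ih]
    linear_combination p (n + 1) * hq n - q (n + 1) * hp n

theorem greenKernel_zero_row (hp0 : p 0 = 1) (hp1 : b 0 * p 0 + a 0 * p 1 = 0) (hq0 : q 0 = 0)
    (hq1 : a 0 * q 1 = 1) (m : ℕ) :
    b 0 * greenKernel p q 0 m + a 0 * greenKernel p q 1 m = if m = 0 then 1 else 0 := by
  unfold greenKernel
  rcases m with _ | _ | m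
  · simp [hp0, hq0, hq1]
  · rw [zero_add, if_neg one_ne_zero, if_neg (by omega), if_pos le_rfl]
    linear_combination q 1 * hp1
  · rw [if_neg (by omega), if_neg (by omega), if_neg (by omega)]
    linear_combination q (m + 2) * hp1

theorem greenKernel_succ_row (hp : IsJacobiSolution a b p) (hq : IsJacobiSolution a b q)
    (hp0 : p 0 = 1) (hq0 : q 0 = 0) (hq1 : a 0 * q 1 = 1) (n m : ℕ) :
    a n * greenKernel p q n m + b (n + 1) * greenKernel p q (n + 1) m +
      a (n + 1) * greenKernel p q (n + 2) m = if m = n + 1 then 1 else 0 := by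
  unfold greenKernel
  rcases lt_trichotomy m (n + 1) with h | rfl | h
  · rw [if_pos (by omega), if_pos (by omega), if_pos (by omega), if_neg (by omega)]
    linear_combination p m * hq n
  · rw [if_neg (by omega), if_pos (by omega), if_pos (by omega), if_pos rfl]
    have hw := hp.wronskian hq n
    rw [hp0, hq0] at hw
    linear_combination p (n + 1) * hq n + hw + hq1
  · rw [if_neg (by omega : ¬ m ≤ n), if_neg (by omega : ¬ m ≤ n + 1),
      if_neg (by omega : ¬ m = n + 1)]
    rcases (Nat.succ_le_of_lt h).eq_or_lt with h' | h'
    · rw [if_pos (by omega), ← h']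
      linear_combination q (n + 2) * hp n
    · rw [if_neg (by omega)]
      linear_combination q m * hp n

/-- The integral operator with the Green kernel solves `𝒜 x = f`. -/
theorem jacobiAction_kernelOperator_greenKernel (hp : IsJacobiSolution a b p)
    (hq : IsJacobiSolution a b q) (hp0 : p 0 = 1) (hp1 : b 0 * p 0 + a 0 * p 1 = 0)
    (hq0 : q 0 = 0) (hq1 : a 0 * q 1 = 1) {c : ℝ}
    (hk : ∀ n m, |greenKernel p q n m| ≤ c / ((max n m : ℕ) + 1 : ℝ)) (f : EllTwo) :
    jacobiAction a b (kernelOperator (greenKernel p q) c hk f : ℕ → ℂ) = f := by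
  have hsum : ∀ n, HasSum (fun m => (greenKernel p q n m : ℂ) * f m)
      (kernelOperator (greenKernel p q) c hk f n) := fun n => (summable_kernel hk f n).hasSum
  have hdelta : ∀ (n : ℕ) (g : ℕ → ℂ),
      (∀ m, g m = ((if m = n then 1 else 0 : ℝ) : ℂ) * f m) → HasSum g (f n) := by
    intro n g hg
    have h := hasSum_single (f := g) n fun m hm => by rw [hg, if_neg hm]; simp
    rwa [hg n, if_pos rfl, Complex.ofReal_one, one_mul] at h
  funext n
  cases n with
  | zero =>
    refine HasSum.unique (((hsum 0).mul_left (b 0 : ℂ)).add ((hsum 1).mul_left (a 0 : ℂ)))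
      (hdelta 0 _ fun m => ?_)
    rw [← greenKernel_zero_row hp0 hp1 hq0 hq1 m]
    push_cast
    ring
  | succ n =>
    refine HasSum.unique ((((hsum n).mul_left (a n : ℂ)).add
      ((hsum (n + 1)).mul_left (b (n + 1) : ℂ))).add
      ((hsum (n + 2)).mul_left (a (n + 1) : ℂ))) (hdelta (n + 1) _ fun m => ?_)
    rw [← greenKernel_succ_row hp hq hp0 hq0 hq1 n m]
    push_cast
    ring

theorem eq_mul_of_jacobiAction_eq_zero (ha : ∀ n, a n ≠ 0) (hp : IsJacobiSolution a b p)
    (hp0 : p 0 = 1) (hp1 : b 0 * p 0 + a 0 * p 1 = 0) {x : ℕ → ℂ} (hx : jacobiAction a b x = 0)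
    (n : ℕ) : x n = x 0 * p n := by
  have key : ∀ n, x n = x 0 * p n ∧ x (n + 1) = x 0 * p (n + 1) := by
    intro n
    induction n with
    | zero =>
      refine ⟨by simp [hp0], ?_⟩
      have h0 : (b 0 : ℂ) * x 0 + a 0 * x 1 = 0 := congrFun hx 0
      have h1 : (b 0 : ℂ) * p 0 + a 0 * p 1 = 0 := by exact_mod_cast hp1
      have ha0 : (a 0 : ℂ) ≠ 0 := by exact_mod_cast ha 0
      refine mul_left_cancel₀ ha0 ?_
      rw [hp0, Complex.ofReal_one] at h1
      linear_combination h0 - x 0 * h1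
    | succ n ih =>
      refine ⟨ih.2, ?_⟩
      have h0 : (a n : ℂ) * x n + b (n + 1) * x (n + 1) + a (n + 1) * x (n + 2) = 0 :=
        congrFun hx (n + 1)
      have h1 : (a n : ℂ) * p n + b (n + 1) * p (n + 1) + a (n + 1) * p (n + 2) = 0 := by
        exact_mod_cast hp n
      have ha0 : (a (n + 1) : ℂ) ≠ 0 := by exact_mod_cast ha (n + 1)
      refine mul_left_cancel₀ ha0 ?_
      rw [ih.1, ih.2] at h0
      linear_combination h0 - x 0 * h1
  exact (key n).1

theorem EllTwo.tendsto_zero (x : EllTwo) : Tendsto (fun n => x n) atTop (𝓝 0) := by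
  rw [tendsto_zero_iff_norm_tendsto_zero]
  have h := (EllTwo.hasSum_norm_sq x).summable.tendsto_atTop_zero.sqrt
  simpa using h

/-- If the solution `p` does not tend to zero, the kernel of the Jacobi operator is trivial. -/
theorem eq_zero_of_jacobiAction_eq_zero (ha : ∀ n, a n ≠ 0) (hp : IsJacobiSolution a b p)
    (hp0 : p 0 = 1) (hp1 : b 0 * p 0 + a 0 * p 1 = 0) (hlim : ¬ Tendsto p atTop (𝓝 0))
    {x : EllTwo} (hx : jacobiAction a b (x : ℕ → ℂ) = 0) : x = 0 := by
  have h := eq_mul_of_jacobiAction_eq_zero ha hp hp0 hp1 hx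
  have hx0 : x 0 = 0 := by
    by_contra h0
    refine hlim ?_
    have h1 := ((EllTwo.tendsto_zero x).const_mul (x 0)⁻¹).norm
    rw [mul_zero, norm_zero] at h1
    rw [tendsto_zero_iff_norm_tendsto_zero]
    refine h1.congr fun n => ?_
    rw [h n, inv_mul_cancel_left₀ h0, Complex.norm_real]
  ext n
  rw [h n, hx0, zero_mul]
  rfl

theorem jacobiOperator_apply_coe (x : (jacobiOperator a b).domain) :
    ((jacobiOperator a b x : EllTwo) : ℕ → ℂ) = jacobiAction a b ((x : EllTwo) : ℕ → ℂ) := rfl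

theorem jacobiOperator_kernelOperator (hp : IsJacobiSolution a b p)
    (hq : IsJacobiSolution a b q) (hp0 : p 0 = 1) (hp1 : b 0 * p 0 + a 0 * p 1 = 0)
    (hq0 : q 0 = 0) (hq1 : a 0 * q 1 = 1) {c : ℝ}
    (hk : ∀ n m, |greenKernel p q n m| ≤ c / ((max n m : ℕ) + 1 : ℝ)) (y : EllTwo) :
    ∃ h : kernelOperator (greenKernel p q) c hk y ∈ (jacobiOperator a b).domain,
      jacobiOperator a b ⟨kernelOperator (greenKernel p q) c hk y, h⟩ = y := by
  have e := jacobiAction_kernelOperator_greenKernel hp hq hp0 hp1 hq0 hq1 hk y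
  have h : kernelOperator (greenKernel p q) c hk y ∈ (jacobiOperator a b).domain := by
    show Memℓp (jacobiAction a b (kernelOperator (greenKernel p q) c hk y : ℕ → ℂ)) 2
    rw [e]
    exact lp.memℓp y
  refine ⟨h, lp.ext ?_⟩
  rw [jacobiOperator_apply_coe]
  exact e

theorem kernelOperator_jacobiOperator (ha : ∀ n, a n ≠ 0) (hp : IsJacobiSolution a b p)
    (hq : IsJacobiSolution a b q) (hp0 : p 0 = 1) (hp1 : b 0 * p 0 + a 0 * p 1 = 0)
    (hq0 : q 0 = 0) (hq1 : a 0 * q 1 = 1) {c : ℝ}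
    (hk : ∀ n m, |greenKernel p q n m| ≤ c / ((max n m : ℕ) + 1 : ℝ))
    (hlim : ¬ Tendsto p atTop (𝓝 0))
    (x : (jacobiOperator a b).domain) :
    kernelOperator (greenKernel p q) c hk (jacobiOperator a b x) = x := by
  obtain ⟨h, e⟩ := jacobiOperator_kernelOperator hp hq hp0 hp1 hq0 hq1 hk (jacobiOperator a b x)
  rw [← sub_eq_zero] at e ⊢
  rw [← LinearPMap.map_sub] at e
  refine eq_zero_of_jacobiAction_eq_zero ha hp hp0 hp1 hlim ?_
  have := congrArg (fun z : EllTwo => (z : ℕ → ℂ)) e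
  exact this

theorem memℓp_two_of_eventually_zero {f : ℕ → ℂ} {K : ℕ} (h : ∀ n, K ≤ n → f n = 0) :
    Memℓp f 2 := by
  refine memℓp_gen (summable_of_ne_finset_zero (s := Finset.range K) fun n hn => ?_)
  rw [h n (by simpa using hn)]
  simp

/-- The piecewise linear cutoff, equal to `1` up to `L` and to `0` from `2 * L` on. -/
def linearCutoff (L n : ℕ) : ℝ := max 0 (min 1 (2 - n / L))

theorem linearCutoff_eq_one {L n : ℕ} (h : n ≤ L) : linearCutoff L n = 1 := by
  have : (n : ℝ) / L ≤ 1 := div_le_one_of_le₀ (by exact_mod_cast h) (by positivity)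
  rw [linearCutoff, min_eq_left (by linarith), max_eq_right zero_le_one]

theorem linearCutoff_eq_zero {L n : ℕ} (hL : 0 < L) (h : 2 * L ≤ n) : linearCutoff L n = 0 := by
  have hL' : (0 : ℝ) < L := by exact_mod_cast hL
  have : 2 ≤ (n : ℝ) / L := by
    rw [le_div_iff₀ hL']; exact_mod_cast h
  exact max_eq_left ((min_le_right _ _).trans (by linarith))

theorem abs_linearCutoff_succ_sub_le (L n : ℕ) :
    |linearCutoff L (n + 1) - linearCutoff L n| ≤ 1 / L := by
  unfold linearCutoff
  refine (abs_max_sub_max_le_max _ _ _ _).trans (max_le (by simp) ?_)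
  refine (abs_min_sub_min_le_max _ _ _ _).trans (max_le (by simp) ?_)
  have : (2 - ((n + 1 : ℕ) : ℝ) / L) - (2 - (n : ℝ) / L) = -(1 / L) := by push_cast; ring
  rw [this, abs_neg, abs_of_nonneg (by positivity)]

/-- If `a n = o(n)` and the solution `p` is bounded and does not vanish on average, then the
functions `p` cut off linearly between `L` and `2 * L` show that the Jacobi operator is not bounded
below, so `0` belongs to its spectrum. -/
theorem zero_mem_opSpectrum_of_isLittleO (ha : ∀ n, 0 < a n) (hp : IsJacobiSolution a b p)
    (hp1 : b 0 * p 0 + a 0 * p 1 = 0) {M : ℝ} (hM : ∀ n, |p n| ≤ M) {N : ℕ} (hN : 0 < N)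
    (hlow : ∀ K : ℕ, (K : ℝ) ≤ ∑ n ∈ Finset.range (K * N), p n ^ 2)
    (hsmall : ∀ ε > 0, ∀ᶠ n : ℕ in atTop, a n ≤ ε * (n + 1)) :
    (0 : ℂ) ∈ opSpectrum (jacobiOperator a b) := by
  rintro ⟨R, -, hR⟩
  have hM0 : 0 ≤ M := (abs_nonneg _).trans (hM 0)
  have hN' : (1 : ℝ) ≤ N := by exact_mod_cast hN
  set C := ‖R‖ with hC
  have hC0 : 0 ≤ C := norm_nonneg _
  set ε : ℝ := 1 / (10 * (C + 1) * (M + 1) * N) with hε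
  have hε0 : 0 < ε := by positivity
  -- The cutoff only varies beyond `L ≥ n₀ + 2`, where `a n ≤ ε * (n + 1)`.
  obtain ⟨n₀, hn₀⟩ := eventually_atTop.1 (hsmall ε hε0)
  set K := n₀ + 2 with hK
  set L := K * N with hL
  have hKL : K ≤ L := Nat.le_mul_of_pos_right K hN
  have hLpos : (0 : ℝ) < L := by exact_mod_cast (by omega : 0 < L)
  set d := linearCutoff L with hd
  set f : ℕ → ℂ := fun n => ((d n * p n : ℝ) : ℂ) with hf
  have hfz : ∀ n, 2 * L ≤ n → f n = 0 := fun n hn => by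
    simp only [hf, hd, linearCutoff_eq_zero (by omega) hn, zero_mul, Complex.ofReal_zero]
  have hact0 : jacobiAction a b f 0 = 0 := by
    have h0 : d 0 = 1 := linearCutoff_eq_one (Nat.zero_le _)
    have h1 : d 1 = 1 := linearCutoff_eq_one (by omega)
    simp only [jacobiAction, hf, h0, h1, one_mul]
    exact_mod_cast hp1
  have hact : ∀ n, jacobiAction a b f (n + 1) =
      ((a (n + 1) * (d (n + 2) - d (n + 1)) * p (n + 2) -
        a n * (d (n + 1) - d n) * p n : ℝ) : ℂ) := by
    intro n
    simp only [jacobiAction, hf]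
    norm_cast
    linear_combination d (n + 1) * hp n
  have hactz : ∀ n, 2 * L + 1 ≤ n → jacobiAction a b f n = 0 := by
    rintro (_ | n) hn
    · exact hact0
    · simp only [jacobiAction, hfz n (by omega), hfz (n + 1) (by omega), hfz (n + 2) (by omega),
        mul_zero, add_zero]
  have hbound : ∀ n, n < 2 * L + 1 → ‖jacobiAction a b f n‖ ≤ 5 * M * ε := by
    rintro (_ | n) hn
    · rw [hact0, norm_zero]; positivity
    · rw [hact, Complex.norm_real, Real.norm_eq_abs]
      by_cases hnL : n + 2 ≤ L
      · have h0 : d n = 1 := linearCutoff_eq_one (by omega)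
        have h1 : d (n + 1) = 1 := linearCutoff_eq_one (by omega)
        have h2 : d (n + 2) = 1 := linearCutoff_eq_one hnL
        rw [h0, h1, h2, sub_self, mul_zero, zero_mul, mul_zero, zero_mul, sub_zero, abs_zero]
        positivity
      · -- Each coefficient is at most `3 * L * ε`, and the cutoff has slope `1 / L`.
        have hterm : ∀ j k : ℕ, ∀ B : ℝ, n₀ ≤ j → (j : ℝ) + 1 ≤ B * L →
            |a j * (d (j + 1) - d j) * p k| ≤ B * (M * ε) := by
          intro j k B hj hjB
          rw [abs_mul, abs_mul, abs_of_pos (ha j)]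
          have h1 : a j ≤ ε * (B * L) := (hn₀ j hj).trans (by gcongr)
          have h2 : |d (j + 1) - d j| ≤ 1 / L := abs_linearCutoff_succ_sub_le L j
          have h3 : 0 ≤ ε * (B * L) := (ha j).le.trans h1
          calc a j * |d (j + 1) - d j| * |p k| ≤ (ε * (B * L)) * (1 / L) * M := by
                gcongr
                exact hM k
            _ = _ := by field_simp
        have hnL' : (n : ℝ) + 1 ≤ 2 * L := by exact_mod_cast (by omega : n + 1 ≤ 2 * L)
        have hnL'' : ((n + 1 : ℕ) : ℝ) + 1 ≤ 3 * L := by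
          exact_mod_cast (by omega : n + 1 + 1 ≤ 3 * L)
        have h1 := hterm n n 2 (by omega) hnL'
        have h2 := hterm (n + 1) (n + 2) 3 (by omega) hnL''
        refine (abs_sub _ _).trans ?_
        linarith
  let x : EllTwo := ⟨f, memℓp_two_of_eventually_zero hfz⟩
  have hx : x ∈ (jacobiOperator a b).domain := memℓp_two_of_eventually_zero hactz
  set y : EllTwo := jacobiOperator a b ⟨x, hx⟩ with hy
  have hyn : ∀ n, y n = jacobiAction a b f n := fun n => rfl
  have hynorm : ‖y‖ ^ 2 ≤ 3 * L * (5 * M * ε) ^ 2 := by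
    have h1 : ‖y‖ ^ 2 = ∑ n ∈ Finset.range (2 * L + 1), ‖y n‖ ^ 2 := by
      refine (EllTwo.hasSum_norm_sq y).unique (hasSum_sum_of_ne_finset_zero fun n hn => ?_)
      rw [hyn, hactz n (by simpa using hn)]
      simp
    rw [h1]
    calc _ ≤ ∑ n ∈ Finset.range (2 * L + 1), (5 * M * ε) ^ 2 := by
          gcongr with n hn
          rw [hyn]
          exact hbound n (Finset.mem_range.1 hn)
      _ = (2 * L + 1 : ℕ) * (5 * M * ε) ^ 2 := by simp
      _ ≤ _ := by
          gcongr
          exact_mod_cast (by omega : 2 * L + 1 ≤ 3 * L)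
  have hxnorm : (K : ℝ) ≤ ‖x‖ ^ 2 := by
    refine (hlow K).trans (le_trans (le_of_eq ?_) (EllTwo.sum_norm_sq_le x (Finset.range L)))
    refine Finset.sum_congr rfl fun n hn => ?_
    have h1 : x n = ((d n * p n : ℝ) : ℂ) := rfl
    have h2 : d n = 1 := linearCutoff_eq_one (Finset.mem_range.1 hn).le
    rw [h1, h2, one_mul, Complex.norm_real, Real.norm_eq_abs, sq_abs]
  have hxy : ‖x‖ ≤ C * ‖y‖ := by
    have h := hR ⟨x, hx⟩
    rw [zero_smul, sub_zero] at h
    calc ‖x‖ = ‖R y‖ := by rw [hy, h]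
      _ ≤ _ := R.le_opNorm y
  -- With `L = K * N` this gives `K ≤ C² * 75 * K * N * M² * ε²`, against the choice of `ε`.
  have hfin : (K : ℝ) ≤ C ^ 2 * (3 * L * (5 * M * ε) ^ 2) := by
    calc (K : ℝ) ≤ ‖x‖ ^ 2 := hxnorm
      _ ≤ (C * ‖y‖) ^ 2 := by gcongr
      _ = C ^ 2 * ‖y‖ ^ 2 := by ring
      _ ≤ _ := by gcongr
  have hLK : (L : ℝ) = K * N := by rw [hL]; push_cast; rfl
  have hKpos : (0 : ℝ) < K := by exact_mod_cast (by omega : 0 < K)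
  have hu : C * M * N * ε ≤ 1 / 10 := by
    have e : (C + 1) * (M + 1) * N * ε = 1 / 10 := by rw [hε]; field_simp
    rw [← e]
    gcongr <;> linarith
  have hu0 : 0 ≤ C * M * N * ε := by positivity
  have hsq : C ^ 2 * (3 * L * (5 * M * ε) ^ 2) * N = K * (75 * (C * M * N * ε) ^ 2) := by
    rw [hLK]; ring
  have h75 : 75 * (C * M * N * ε) ^ 2 < 1 := by nlinarith
  have : (K : ℝ) * N < K * 1 := by
    calc (K : ℝ) * N ≤ C ^ 2 * (3 * L * (5 * M * ε) ^ 2) * N := by gcongr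
      _ = K * (75 * (C * M * N * ε) ^ 2) := hsq
      _ < _ := by gcongr
  nlinarith

end Jacobi

/-! ### Solutions of the periodic and of the modulated recurrence -/

section PeriodicSolution

/-- The solution of the recurrence with initial values `v 0`, `v 1` at the indices `0`, `1`,
read off from the transfer matrices. -/
def transferSolution (α β : ℕ → ℝ) (v : Fin 2 → ℝ) (n : ℕ) : ℝ :=
  (transferProduct α β n).mulVec v 0

variable {α β : ℕ → ℝ}

theorem transferSolution_succ (v : Fin 2 → ℝ) (n : ℕ) :
    transferSolution α β v (n + 1) = (transferProduct α β n).mulVec v 1 := by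
  unfold transferSolution
  rw [transferProduct, ← Matrix.mulVec_mulVec]
  simp [transferMatrix, Matrix.mulVec, dotProduct, Fin.sum_univ_two]

theorem transferSolution_zero (v : Fin 2 → ℝ) : transferSolution α β v 0 = v 0 := by
  simp [transferSolution, transferProduct]

theorem transferSolution_one (v : Fin 2 → ℝ) : transferSolution α β v 1 = v 1 := by
  exact (transferSolution_succ v 0).trans (by simp [transferProduct])

theorem isJacobiSolution_transferSolution (hα : ∀ n, 0 < α n) (v : Fin 2 → ℝ) :
    IsJacobiSolution α β (transferSolution α β v) := by
  intro n
  have h : transferSolution α β v (n + 2) = -(α n / α (n + 1)) * transferSolution α β v n -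
      β (n + 1) / α (n + 1) * transferSolution α β v (n + 1) := by
    rw [transferSolution_succ v (n + 1), transferSolution_succ v n]
    unfold transferSolution
    rw [transferProduct, ← Matrix.mulVec_mulVec]
    simp [transferMatrix, Matrix.mulVec, dotProduct, Fin.sum_univ_two]
    ring
  have := (hα (n + 1)).ne'
  rw [h]
  field_simp
  ring

variable {N : ℕ} {γ : ℝ}

theorem transferSolution_add_period (hα : ∀ n, 0 < α n) (hα_per : Function.Periodic α N)
    (hβ_per : Function.Periodic β N)
    (hF : transferProduct α β N = γ • (1 : Matrix (Fin 2) (Fin 2) ℝ)) (v : Fin 2 → ℝ) (n : ℕ) :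
    transferSolution α β v (n + N) = γ * transferSolution α β v n := by
  have key : ∀ n, transferSolution α β v (n + N) = γ * transferSolution α β v n ∧
      transferSolution α β v (n + 1 + N) = γ * transferSolution α β v (n + 1) := by
    intro n
    induction n with
    | zero =>
      rw [zero_add, zero_add, add_comm 1 N, transferSolution_succ, transferSolution_zero,
        transferSolution_one, transferSolution, hF, Matrix.smul_mulVec, Matrix.one_mulVec]
      exact ⟨rfl, rfl⟩
    | succ n ih =>
      refine ⟨ih.2, mul_left_cancel₀ (hα (n + 1)).ne' ?_⟩
      have h1 := isJacobiSolution_transferSolution (β := β) hα v n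
      have h2 := isJacobiSolution_transferSolution (β := β) hα v (n + N)
      rw [show n + N + 1 = n + 1 + N by ring, show n + N + 2 = n + 1 + 1 + N by ring, hα_per,
        hα_per, hβ_per, ih.1, ih.2] at h2
      linear_combination h2 - γ * h1
  exact (key n).1

theorem transferSolution_mul_period_add (hα : ∀ n, 0 < α n) (hα_per : Function.Periodic α N)
    (hβ_per : Function.Periodic β N)
    (hF : transferProduct α β N = γ • (1 : Matrix (Fin 2) (Fin 2) ℝ)) (v : Fin 2 → ℝ) (k i : ℕ) :
    transferSolution α β v (k * N + i) = γ ^ k * transferSolution α β v i := by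
  induction k with
  | zero => simp
  | succ k ih =>
    rw [show (k + 1) * N + i = k * N + i + N by ring,
      transferSolution_add_period hα hα_per hβ_per hF, ih]
    ring

theorem exists_abs_transferSolution_le (hN : 0 < N) (hα : ∀ n, 0 < α n)
    (hα_per : Function.Periodic α N) (hβ_per : Function.Periodic β N) (hγ : |γ| = 1)
    (hF : transferProduct α β N = γ • (1 : Matrix (Fin 2) (Fin 2) ℝ)) (v : Fin 2 → ℝ) :
    ∃ M, ∀ n, |transferSolution α β v n| ≤ M := by
  refine ⟨∑ i ∈ Finset.range N, |transferSolution α β v i|, fun n => ?_⟩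
  have h := transferSolution_mul_period_add hα hα_per hβ_per hF v (n / N) (n % N)
  rw [mul_comm, Nat.div_add_mod] at h
  rw [h, abs_mul, abs_pow, hγ, one_pow, one_mul]
  exact Finset.single_le_sum (f := fun i => |transferSolution α β v i|)
    (fun _ _ => abs_nonneg _) (Finset.mem_range.2 (Nat.mod_lt n hN))

/-- The periodic (up to the sign `γ`) solution satisfying the initial condition at the index `0`. -/
def regularSolution (α β : ℕ → ℝ) : ℕ → ℝ := transferSolution α β ![1, -(β 0 / α 0)]

/-- The periodic (up to the sign `γ`) solution vanishing at the index `0`, hence at all multiples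
of the period. -/
def vanishingSolution (α β : ℕ → ℝ) : ℕ → ℝ := transferSolution α β ![0, 1 / α 0]

end PeriodicSolution

section Modulation

variable {N : ℕ} {α β : ℕ → ℝ} {γ : ℝ} {t a b : ℕ → ℝ}

theorem eq_mul_of_blockwise (hN : 0 < N) (hα_per : Function.Periodic α N)
    (ha : ∀ k i, i < N → a (k * N + i) = α i * t k) (n : ℕ) : a n = α n * t (n / N) := by
  have h := ha (n / N) (n % N) (Nat.mod_lt n hN)
  rwa [mul_comm, Nat.div_add_mod, hα_per.map_mod_nat] at h

theorem div_succ_eq_or_exists_mul (N n : ℕ) :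
    (n + 1) / N = n / N ∨ ∃ k, n + 1 = k * N + 0 := by
  rw [Nat.succ_div]
  split_ifs with h
  · obtain ⟨k, hk⟩ := h
    exact Or.inr ⟨k, by rw [hk, mul_comm]; rfl⟩
  · exact Or.inl rfl

/-- The modulation of the entries does not affect the solution `p` with the right initial condition
at `0`: at the start of each block the recurrence splits into two equations, each carrying a
single factor `t k`. -/
theorem isJacobiSolution_regularSolution (hα : ∀ n, 0 < α n)
    (hα_per : Function.Periodic α N) (hβ_per : Function.Periodic β N)
    (hF : transferProduct α β N = γ • (1 : Matrix (Fin 2) (Fin 2) ℝ))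
    (ha : ∀ n, a n = α n * t (n / N)) (hb : ∀ n, b n = β n * t (n / N)) :
    IsJacobiSolution a b (regularSolution α β) := by
  intro n
  have h := isJacobiSolution_transferSolution (β := β) hα ![1, -(β 0 / α 0)] n
  change α n * regularSolution α β n + β (n + 1) * regularSolution α β (n + 1) +
    α (n + 1) * regularSolution α β (n + 2) = 0 at h
  rw [ha, ha, hb]
  rcases div_succ_eq_or_exists_mul N n with e | ⟨k, hk⟩
  · rw [e]
    linear_combination t (n / N) * h
  · have h0 : β (n + 1) * regularSolution α β (n + 1) +
        α (n + 1) * regularSolution α β (n + 2) = 0 := by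
      have e1 := transferSolution_mul_period_add hα hα_per hβ_per hF ![1, -(β 0 / α 0)] k 0
      have e2 := transferSolution_mul_period_add hα hα_per hβ_per hF ![1, -(β 0 / α 0)] k 1
      have e3 : β (n + 1) = β 0 := by rw [hk, add_comm]; exact hβ_per.nat_mul k 0
      have e4 : α (n + 1) = α 0 := by rw [hk, add_comm]; exact hα_per.nat_mul k 0
      rw [e3, e4, regularSolution, show n + 2 = k * N + 1 by omega, hk, e1, e2,
        transferSolution_zero, transferSolution_one]
      have := (hα 0).ne'
      simp only [Matrix.cons_val_zero, Matrix.cons_val_one]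
      field_simp
      ring
    linear_combination t ((n + 1) / N) * h0 + t (n / N) * (h - h0)

/-- Dividing the vanishing solution by the modulation gives a solution for the modulated entries:
where the block changes, the solution is zero. -/
theorem mul_vanishingSolution_div (hα : ∀ n, 0 < α n)
    (hα_per : Function.Periodic α N) (hβ_per : Function.Periodic β N)
    (hF : transferProduct α β N = γ • (1 : Matrix (Fin 2) (Fin 2) ℝ)) (ht : ∀ k, 0 < t k)
    (ha : ∀ n, a n = α n * t (n / N)) (n : ℕ) :
    a n * (vanishingSolution α β (n + 1) / t ((n + 1) / N)) =
      α n * vanishingSolution α β (n + 1) := by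
  have ht' := (ht (n / N)).ne'
  rw [ha]
  rcases div_succ_eq_or_exists_mul N n with e | ⟨k, hk⟩
  · rw [e]
    field_simp
  · have : vanishingSolution α β (n + 1) = 0 := by
      rw [hk, vanishingSolution, transferSolution_mul_period_add hα hα_per hβ_per hF,
        transferSolution_zero]
      simp
    rw [this, zero_div, mul_zero, mul_zero]

theorem isJacobiSolution_vanishingSolution_div (hα : ∀ n, 0 < α n)
    (hα_per : Function.Periodic α N) (hβ_per : Function.Periodic β N)
    (hF : transferProduct α β N = γ • (1 : Matrix (Fin 2) (Fin 2) ℝ)) (ht : ∀ k, 0 < t k)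
    (ha : ∀ n, a n = α n * t (n / N)) (hb : ∀ n, b n = β n * t (n / N)) :
    IsJacobiSolution a b (fun n => vanishingSolution α β n / t (n / N)) := by
  intro n
  simp only
  rw [mul_vanishingSolution_div hα hα_per hβ_per hF ht ha (n + 1), ha, hb]
  have h1 := (ht (n / N)).ne'
  have h2 := (ht ((n + 1) / N)).ne'
  refine Eq.trans ?_ (isJacobiSolution_transferSolution (β := β) hα ![0, 1 / α 0] n)
  change _ = α n * vanishingSolution α β n + β (n + 1) * vanishingSolution α β (n + 1) +
    α (n + 1) * vanishingSolution α β (n + 2)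
  field_simp

theorem regularSolution_zero (α β : ℕ → ℝ) : regularSolution α β 0 = 1 := by
  rw [regularSolution, transferSolution_zero]
  rfl

theorem regularSolution_mul_period_sq (hα : ∀ n, 0 < α n)
    (hα_per : Function.Periodic α N) (hβ_per : Function.Periodic β N) (hγ : |γ| = 1)
    (hF : transferProduct α β N = γ • (1 : Matrix (Fin 2) (Fin 2) ℝ)) (k : ℕ) :
    regularSolution α β (k * N) ^ 2 = 1 := by
  have h : regularSolution α β (k * N) = γ ^ k * regularSolution α β 0 :=
    transferSolution_mul_period_add hα hα_per hβ_per hF _ k 0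
  rw [h, regularSolution_zero, mul_one, ← sq_abs, abs_pow, hγ, one_pow, one_pow]

theorem le_sum_regularSolution_sq (hN : 0 < N) (hα : ∀ n, 0 < α n)
    (hα_per : Function.Periodic α N) (hβ_per : Function.Periodic β N) (hγ : |γ| = 1)
    (hF : transferProduct α β N = γ • (1 : Matrix (Fin 2) (Fin 2) ℝ)) (K : ℕ) :
    (K : ℝ) ≤ ∑ n ∈ Finset.range (K * N), regularSolution α β n ^ 2 := by
  have hinj : Set.InjOn (fun k : ℕ => k * N) (Finset.range K) :=
    fun _ _ _ _ h => Nat.eq_of_mul_eq_mul_right hN h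
  calc (K : ℝ) = ∑ k ∈ Finset.range K, regularSolution α β (k * N) ^ 2 := by
        simp [regularSolution_mul_period_sq hα hα_per hβ_per hγ hF]
    _ = ∑ n ∈ (Finset.range K).image (fun k => k * N), regularSolution α β n ^ 2 :=
        (Finset.sum_image (f := fun n => regularSolution α β n ^ 2) hinj).symm
    _ ≤ _ := by
        refine Finset.sum_le_sum_of_subset_of_nonneg (fun n hn => ?_) (fun _ _ _ => sq_nonneg _)
        obtain ⟨k, hk, rfl⟩ := Finset.mem_image.1 hn
        exact Finset.mem_range.2 (Nat.mul_lt_mul_of_pos_right (Finset.mem_range.1 hk) hN)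

theorem not_tendsto_regularSolution (hN : 0 < N) (hα : ∀ n, 0 < α n)
    (hα_per : Function.Periodic α N) (hβ_per : Function.Periodic β N) (hγ : |γ| = 1)
    (hF : transferProduct α β N = γ • (1 : Matrix (Fin 2) (Fin 2) ℝ)) :
    ¬ Tendsto (regularSolution α β) atTop (𝓝 0) := by
  intro h
  have hsub : Tendsto (fun k : ℕ => k * N) atTop atTop :=
    tendsto_atTop_mono (fun k => Nat.le_mul_of_pos_right k hN) tendsto_id
  have h1 := (h.comp hsub).pow 2
  simp only [Function.comp_apply, regularSolution_mul_period_sq hα hα_per hβ_per hγ hF] at h1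
  simpa using tendsto_nhds_unique tendsto_const_nhds h1

theorem mul_regularSolution_one (hα : ∀ n, 0 < α n) :
    β 0 * regularSolution α β 0 + α 0 * regularSolution α β 1 = 0 := by
  rw [regularSolution, transferSolution_zero, transferSolution_one]
  have := (hα 0).ne'
  simp only [Matrix.cons_val_zero, Matrix.cons_val_one]
  field_simp
  ring

theorem tendsto_nat_div_atTop (hN : 0 < N) : Tendsto (fun n : ℕ => n / N) atTop atTop :=
  tendsto_atTop.2 fun k => eventually_atTop.2
    ⟨k * N, fun _ hn => (Nat.le_div_iff_mul_le hN).2 hn⟩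

/-- At the indices `n` of a block `k ≥ 1` one has `n + 1 ≤ 2 * N * k`, so the bound `k / t k ≤ C`
turns into decay of order `1 / n` of a bounded sequence divided by the modulation. -/
theorem div_block_le {v : ℕ → ℝ} {B C : ℝ} (hN : 0 < N) (ht : ∀ k, 0 < t k) (hB : ∀ n, |v n| ≤ B)
    {n : ℕ} (hn : 1 ≤ n / N) (hC : ((n / N : ℕ) : ℝ) / t (n / N) ≤ C) :
    |v n / t (n / N)| ≤ 2 * N * C * B / (n + 1) := by
  have ht' := ht (n / N)
  have hB0 : 0 ≤ B := (abs_nonneg _).trans (hB n)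
  rw [div_le_iff₀ ht'] at hC
  have h1 : (n : ℝ) + 1 ≤ 2 * N * (n / N : ℕ) := by
    have h2 : n < N * (n / N + 1) := by
      have := Nat.div_add_mod n N
      have := Nat.mod_lt n hN
      rw [mul_add]
      omega
    have h3 : n + 1 ≤ 2 * N * (n / N) := by nlinarith
    exact_mod_cast h3
  rw [abs_div, abs_of_pos ht', div_le_div_iff₀ ht' (by positivity)]
  calc |v n| * ((n : ℝ) + 1) ≤ B * (2 * N * (C * t (n / N))) := by
        gcongr
        · exact hB n
        · exact h1.trans (by gcongr)
    _ = _ := by ring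

theorem exists_div_block_le {v : ℕ → ℝ} {B C : ℝ} (hN : 0 < N) (ht : ∀ k, 0 < t k)
    (hB : ∀ n, |v n| ≤ B) (hC : ∀ k : ℕ, 1 ≤ k → |(k : ℝ) / t k| ≤ C) :
    ∃ D, ∀ n, |v n / t (n / N)| ≤ D / ((n : ℝ) + 1) := by
  have hB0 : 0 ≤ B := (abs_nonneg _).trans (hB 0)
  have hC0 : 0 ≤ C := (abs_nonneg _).trans (hC 1 le_rfl)
  have ht0 := ht 0
  refine ⟨2 * N * C * B + N * B / t 0, fun n => ?_⟩
  rw [add_div]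
  rcases Nat.eq_zero_or_pos (n / N) with h | h
  · have hn : n + 1 ≤ N := by
      rcases Nat.div_eq_zero_iff.1 h with h | h <;> omega
    have hn' : (n : ℝ) + 1 ≤ N := by exact_mod_cast hn
    refine le_trans ?_ (le_add_of_nonneg_left (by positivity))
    rw [h, abs_div, abs_of_pos ht0, div_right_comm]
    gcongr
    rw [le_div_iff₀ (by positivity), mul_comm]
    exact mul_le_mul hn' (hB n) (abs_nonneg _) (by positivity)
  · exact (div_block_le hN ht hB h ((le_abs_self _).trans (hC _ h))).trans
      (le_add_of_nonneg_right (by positivity))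

theorem eventually_div_block_le {v : ℕ → ℝ} {B : ℝ} (hN : 0 < N) (ht : ∀ k, 0 < t k)
    (hB : ∀ n, |v n| ≤ B) (hlim : Tendsto (fun k : ℕ => (k : ℝ) / t k) atTop (𝓝 0))
    {ε : ℝ} (hε : 0 < ε) : ∀ᶠ n : ℕ in atTop, |v n / t (n / N)| ≤ ε / ((n : ℝ) + 1) := by
  have hB0 : 0 ≤ B := (abs_nonneg _).trans (hB 0)
  have hN' : (0 : ℝ) < N := by exact_mod_cast hN
  have hev := (hlim.eventually_le_const (u := ε / (2 * N * (B + 1))) (by positivity)).and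
    (eventually_ge_atTop 1)
  filter_upwards [(tendsto_nat_div_atTop hN).eventually hev] with n hn
  refine (div_block_le hN ht hB hn.2 hn.1).trans ?_
  gcongr
  calc 2 * N * (ε / (2 * N * (B + 1))) * B = ε * (B / (B + 1)) := by field_simp
    _ ≤ ε * 1 := by
      gcongr
      exact div_le_one_of_le₀ (by linarith) (by positivity)
    _ = ε := mul_one ε

theorem eventually_entry_le (hN : 0 < N) (hα : ∀ n, 0 < α n) (hα_per : Function.Periodic α N)
    (ht : ∀ k, 0 < t k) (ha : ∀ n, a n = α n * t (n / N))
    (hlim : Tendsto (fun k : ℕ => (k : ℝ) / t k) atTop atTop) {ε : ℝ} (hε : 0 < ε) :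
    ∀ᶠ n : ℕ in atTop, a n ≤ ε * (n + 1) := by
  set A := ∑ i ∈ Finset.range N, α i with hA
  have hαA : ∀ n, α n ≤ A := fun n => by
    rw [← hα_per.map_mod_nat]
    exact Finset.single_le_sum (fun i _ => (hα i).le) (Finset.mem_range.2 (Nat.mod_lt n hN))
  have hA0 : 0 < A := (hα 0).trans_le (hαA 0)
  filter_upwards [(tendsto_nat_div_atTop hN).eventually (hlim.eventually_ge_atTop (A / ε))] with n hn
  have ht' := ht (n / N)
  rw [le_div_iff₀ ht', div_mul_eq_mul_div, div_le_iff₀ hε] at hn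
  have h1 : ((n / N : ℕ) : ℝ) ≤ n := by exact_mod_cast Nat.div_le_self n N
  calc a n = α n * t (n / N) := ha n
    _ ≤ A * t (n / N) := by gcongr; exact hαA n
    _ ≤ (n / N : ℕ) * ε := hn
    _ ≤ ε * (n + 1) := by nlinarith

end Modulation

end

theorem theoremB (N : ℕ) (hN : 0 < N)
    (α β : ℕ → ℝ) (hα : ∀ n, 0 < α n)
    (hα_per : Function.Periodic α N) (hβ_per : Function.Periodic β N)
    (γ : ℝ) (hγ : |γ| = 1)
    (hF : transferProduct α β N = γ • (1 : Matrix (Fin 2) (Fin 2) ℝ))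
    (t : ℕ → ℝ) (ht : ∀ k, 0 < t k)
    (a b : ℕ → ℝ)
    (ha : ∀ k i, i < N → a (k * N + i) = α i * t k)
    (hb : ∀ k i, i < N → b (k * N + i) = β i * t k) :
    (Tendsto (fun k : ℕ => (k : ℝ) / t k) atTop atTop →
      (0 : ℂ) ∈ opEssentialSpectrum (jacobiOperator a b)) ∧
    ((∃ C : ℝ, ∀ k : ℕ, 1 ≤ k → |(k : ℝ) / t k| ≤ C) →
      (0 : ℂ) ∉ opEssentialSpectrum (jacobiOperator a b)) ∧
    (Tendsto (fun k : ℕ => (k : ℝ) / t k) atTop (𝓝 0) →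
      opEssentialSpectrum (jacobiOperator a b) = ∅) := by
  replace ha := eq_mul_of_blockwise hN hα_per ha
  replace hb := eq_mul_of_blockwise hN hβ_per hb
  have ha_pos : ∀ n, 0 < a n := fun n => by rw [ha]; exact mul_pos (hα n) (ht _)
  have ha_ne : ∀ n, a n ≠ 0 := fun n => (ha_pos n).ne'
  set p := regularSolution α β
  have hp : IsJacobiSolution a b p := isJacobiSolution_regularSolution hα hα_per hβ_per hF ha hb
  have hp0 : p 0 = 1 := regularSolution_zero α β
  have hp1 : b 0 * p 0 + a 0 * p 1 = 0 := by
    rw [ha, hb]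
    linear_combination t (0 / N) * mul_regularSolution_one (β := β) hα
  have hp_lim : ¬ Tendsto p atTop (𝓝 0) := not_tendsto_regularSolution hN hα hα_per hβ_per hγ hF
  obtain ⟨M, hM⟩ : ∃ M, ∀ n, |p n| ≤ M :=
    exists_abs_transferSolution_le hN hα hα_per hβ_per hγ hF _
  obtain ⟨B, hB⟩ : ∃ B, ∀ n, |vanishingSolution α β n| ≤ B :=
    exists_abs_transferSolution_le hN hα hα_per hβ_per hγ hF _
  set q : ℕ → ℝ := fun n => vanishingSolution α β n / t (n / N) with hq_def
  have hq : IsJacobiSolution a b q :=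
    isJacobiSolution_vanishingSolution_div hα hα_per hβ_per hF ht ha hb
  have hq0 : q 0 = 0 := by
    simp only [hq_def, vanishingSolution, transferSolution_zero]
    simp
  have hq1 : a 0 * q 1 = 1 := by
    refine (mul_vanishingSolution_div hα hα_per hβ_per hF ht ha 0).trans ?_
    rw [vanishingSolution, zero_add, transferSolution_one]
    have := (hα 0).ne'
    simp [this]
  have hkernel : (∃ C : ℝ, ∀ k : ℕ, 1 ≤ k → |(k : ℝ) / t k| ≤ C) →
      ∃ c, ∀ n m, |greenKernel p q n m| ≤ c / ((max n m : ℕ) + 1 : ℝ) := by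
    rintro ⟨C, hC⟩
    obtain ⟨D, hD⟩ := exists_div_block_le hN ht hB hC
    exact ⟨M * D, fun n m => abs_greenKernel_le hM (hD _)⟩
  refine ⟨fun hlim => ?_, fun hC => ?_, fun hlim => ?_⟩
  · refine ⟨zero_mem_opSpectrum_of_isLittleO ha_pos hp hp1 hM hN
      (le_sum_regularSolution_sq hN hα hα_per hβ_per hγ hF)
      (fun ε hε => eventually_entry_le hN hα hα_per ht ha hlim hε), fun hd => hd.2.2.1 ?_⟩
    refine (opEigenspace_eq_bot_iff _ _).2 fun x hx => Subtype.ext ?_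
    rw [zero_smul] at hx
    exact eq_zero_of_jacobiAction_eq_zero ha_ne hp hp0 hp1 hp_lim
      (congrArg (fun z : EllTwo => (z : ℕ → ℂ)) hx)
  · obtain ⟨c, hk⟩ := hkernel hC
    exact fun h => h.1 (zero_mem_opResolventSet
      (jacobiOperator_kernelOperator hp hq hp0 hp1 hq0 hq1 hk)
      (kernelOperator_jacobiOperator ha_ne hp hq hp0 hp1 hq0 hq1 hk hp_lim))
  · obtain ⟨C, hC⟩ := hlim.abs.bddAbove_range
    obtain ⟨c, hk⟩ := hkernel ⟨C, fun k _ => hC ⟨k, rfl⟩⟩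
    have hM0 : 0 ≤ M := (abs_nonneg _).trans (hM 0)
    refine opEssentialSpectrum_eq_empty
      (jacobiOperator_kernelOperator hp hq hp0 hp1 hq0 hq1 hk)
      (kernelOperator_jacobiOperator ha_ne hp hq hp0 hp1 hq0 hq1 hk hp_lim)
      (kernelOperator_isCompactOperator hk fun ε hε => ?_)
      (kernelOperator_isSymmetric hk (greenKernel_symm p q))
    obtain ⟨L, hL⟩ := eventually_atTop.1
      (eventually_div_block_le hN ht hB hlim (ε := ε / (M + 1)) (by positivity))
    refine ⟨L, fun n hn m => (abs_greenKernel_le hM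
      (hL _ (hn.trans (le_max_left n m)))).trans ?_⟩
    gcongr
    calc M * (ε / (M + 1)) = ε * (M / (M + 1)) := by ring
      _ ≤ ε * 1 := by
        gcongr
        exact div_le_one_of_le₀ (by linarith) (by positivity)
      _ = ε := mul_one ε
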